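/- Let $N\ge 2$, $\alpha\in(\tfrac12,1)$, and let $\Omega\subset\mathbb{R}^N$ be a bounded open set with $C^2$ boundary (locally the region strictly on one side of the graph of a $C^2$ function; connectedness is not required). Let $$c_{N,\alpha}=\frac{4^{\alpha}\,\alpha\,\Gamma(\frac N2+\alpha)}{\pi^{N/2}\,\Gamma(1-\alpha)}$$ be the normalizing constant of the fractional Laplacian. For $u\in L^2(\Omega)$ put $$\|u\|_{H_0^\alpha(\Omega)}:=\left(\frac{c_{N,\alpha}}2\int_\Omega\int_\Omega \frac{[u(x)-u(y)]^2}{|x-y|^{N+2\alpha}}\,dx\,dy\right)^{1/2},\qquad \|u\|_{H^\alpha(\Omega)}:=\|u\|_{H_0^\alpha(\Omega)}+\|u\|_{L^2(\Omega)},$$ let $H^\alpha(\Omega)$ be the space of all $u\in L^2(\Omega)$ for which these quantities are finite, and let $H_0^\alpha(\Omega)$ be the closure in $H^\alpha(\Omega)$ of $C_c^2(\Omega)$, the $C^2$ functions with compact support in $\Omega$, under $\|\cdot\|_{H^\alpha(\Omega)}$. Then $\|\cdot\|_{H^\alpha(\Omega)}$ and $\|\cdot\|_{H_0^\alpha(\Omega)}$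 are equivalent norms on $H_0^\alpha(\Omega)$: both are norms there, and there are constants $c,C>0$, independent of $u$, such that $$c\,\|u\|_{H_0^\alpha(\Omega)}\le \|u\|_{H^\alpha(\Omega)}\le C\,\|u\|_{H_0^\alpha(\Omega)}\qquad\text{for all } u\in H_0^\alpha(\Omega).$$ -/

import Mathlib

open MeasureTheory
open scoped ENNReal

noncomputable section

namespace RegionalFractional

/-- An open set `Ω` of a Euclidean space has `C²` boundary: near each boundary point `x₀` there are
a unit vector `e` and a `C²` function `γ` on the hyperplane orthogonal to `e` such that, in a ball
around `x₀`, the set `Ω` is exactly the region strictly above the graph of `γ` in direction `e`. -/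
def HasC2Boundary {N : ℕ} (Ω : Set (EuclideanSpace ℝ (Fin N))) : Prop :=
  ∀ x₀ ∈ frontier Ω, ∃ e : EuclideanSpace ℝ (Fin N), ‖e‖ = 1 ∧
    ∃ γ : (Submodule.span ℝ {e})ᗮ → ℝ, ContDiff ℝ 2 γ ∧
      ∃ r : ℝ, 0 < r ∧ ∀ x ∈ Metric.ball x₀ r,
        (x ∈ Ω ↔ γ ((Submodule.span ℝ {e})ᗮ.orthogonalProjectionOnto x) < inner ℝ e x)

/-- The normalizing constant `c_{N,α}` of the fractional Laplacian `(-Δ)^α` on `ℝ^N`,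
`c_{N,α} = 4^α α Γ(N/2 + α) / (π^{N/2} Γ(1 - α))`. -/
def fracConst (N : ℕ) (α : ℝ) : ℝ :=
  4 ^ α * α * Real.Gamma ((N : ℝ) / 2 + α) / (Real.pi ^ ((N : ℝ) / 2) * Real.Gamma (1 - α))

/-- The regional Gagliardo energy `∫_Ω ∫_Ω (u(x) - u(y))² / |x - y|^{N + 2α} dx dy ∈ [0, ∞]`. -/
def energy {N : ℕ} (α : ℝ) (Ω : Set (EuclideanSpace ℝ (Fin N)))
    (u : EuclideanSpace ℝ (Fin N) → ℝ) : ℝ≥0∞ :=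
  ∫⁻ x in Ω, ∫⁻ y in Ω, ENNReal.ofReal ((u x - u y) ^ 2 / ‖x - y‖ ^ ((N : ℝ) + 2 * α))

/-- The difference quotient whose square is the integrand of `energy`. -/
def quot {N : ℕ} (α : ℝ) (u : EuclideanSpace ℝ (Fin N) → ℝ)
    (p : EuclideanSpace ℝ (Fin N) × EuclideanSpace ℝ (Fin N)) : ℝ :=
  (u p.1 - u p.2) * (‖p.1 - p.2‖ ^ (((N : ℝ) + 2 * α) / 2))⁻¹

section helpers

variable {N : ℕ} {α : ℝ} {Ω : Set (EuclideanSpace ℝ (Fin N))}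

theorem aestronglyMeasurable_quot {u : EuclideanSpace ℝ (Fin N) → ℝ}
    (hu : AEStronglyMeasurable u (volume.restrict Ω)) :
    AEStronglyMeasurable (quot α u) ((volume.restrict Ω).prod (volume.restrict Ω)) := by
  refine AEStronglyMeasurable.mul (hu.comp_fst.sub hu.comp_snd) ?_
  refine Measurable.aestronglyMeasurable ?_
  fun_prop

theorem energy_congr {u v : EuclideanSpace ℝ (Fin N) → ℝ}
    (h : u =ᵐ[volume.restrict Ω] v) : energy α Ω u = energy α Ω v := by
  unfold energy
  refine lintegral_congr_ae ?_
  filter_upwards [h] with x hx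
  refine lintegral_congr_ae ?_
  filter_upwards [h] with y hy
  rw [hx, hy]

theorem energy_eq_eLpNorm {u : EuclideanSpace ℝ (Fin N) → ℝ}
    (hu : AEStronglyMeasurable u (volume.restrict Ω)) :
    energy α Ω u
      = eLpNorm (quot α u) 2 ((volume.restrict Ω).prod (volume.restrict Ω)) ^ 2 := by
  have hq := aestronglyMeasurable_quot (α := α) hu
  have h2 : eLpNorm (quot α u) 2 ((volume.restrict Ω).prod (volume.restrict Ω)) ^ 2
      = ∫⁻ p, ‖quot α u p‖ₑ ^ 2 ∂((volume.restrict Ω).prod (volume.restrict Ω)) := by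
    have := eLpNorm_nnreal_pow_eq_lintegral (f := quot α u) (p := 2)
      (μ := (volume.restrict Ω).prod (volume.restrict Ω)) (by norm_num)
    simpa using this
  rw [h2, lintegral_prod _ (hq.enorm.pow_const 2)]
  unfold energy
  congr 1
  ext x
  congr 1
  ext y
  rw [Real.enorm_eq_ofReal_abs, ← ENNReal.ofReal_pow (abs_nonneg _), sq_abs]
  congr 1
  unfold quot
  rw [mul_pow, inv_pow, ← Real.rpow_natCast (‖x - y‖ ^ _) 2, ← Real.rpow_mul (norm_nonneg _),
    div_eq_mul_inv]
  norm_num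

theorem energy_lt_top_iff {u : EuclideanSpace ℝ (Fin N) → ℝ}
    (hu : AEStronglyMeasurable u (volume.restrict Ω)) :
    energy α Ω u < ∞ ↔
      MemLp (quot α u) 2 ((volume.restrict Ω).prod (volume.restrict Ω)) := by
  rw [energy_eq_eLpNorm hu, MemLp, ENNReal.pow_lt_top_iff]
  simp [aestronglyMeasurable_quot hu]

theorem quot_add (u v : EuclideanSpace ℝ (Fin N) → ℝ) :
    quot α (u + v) = quot α u + quot α v := by
  ext p; simp only [quot, Pi.add_apply]; ring

theorem quot_smul (c : ℝ) (u : EuclideanSpace ℝ (Fin N) → ℝ) :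
    quot α (c • u) = c • quot α u := by
  ext p; simp only [quot, Pi.smul_apply, smul_eq_mul]; ring

theorem energy_zero : energy α Ω (0 : EuclideanSpace ℝ (Fin N) → ℝ) = 0 := by
  simp [energy]

theorem fracConst_pos (hα : α ∈ Set.Ioo (0 : ℝ) 1) : 0 < fracConst N α := by
  have h1 := hα.1
  have h2 := hα.2
  have : 0 < Real.Gamma ((N : ℝ) / 2 + α) := Real.Gamma_pos_of_pos (by positivity)
  have : 0 < Real.Gamma (1 - α) := Real.Gamma_pos_of_pos (by linarith)
  have := Real.pi_pos
  unfold fracConst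
  positivity

end helpers

/-- The fractional Sobolev space `H^α(Ω)`: the (classes of) functions in `L²(Ω)` of finite regional
Gagliardo energy. -/
def HSpace {N : ℕ} (α : ℝ) (Ω : Set (EuclideanSpace ℝ (Fin N))) :
    Submodule ℝ (Lp ℝ 2 (volume.restrict Ω)) where
  carrier := {u | energy α Ω u < ∞}
  zero_mem' := by
    have : energy α Ω ((0 : Lp ℝ 2 (volume.restrict Ω)) : EuclideanSpace ℝ (Fin N) → ℝ) = 0 := by
      rw [energy_congr (Lp.coeFn_zero ℝ 2 _), energy_zero]
    exact this.trans_lt ENNReal.zero_lt_top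
  add_mem' := by
    intro u v hu hv
    have hu' := (energy_lt_top_iff (Lp.aestronglyMeasurable u)).1 hu
    have hv' := (energy_lt_top_iff (Lp.aestronglyMeasurable v)).1 hv
    change energy α Ω _ < ∞
    rw [energy_congr (Lp.coeFn_add u v), energy_lt_top_iff
      ((Lp.aestronglyMeasurable u).add (Lp.aestronglyMeasurable v)), quot_add]
    exact hu'.add hv'
  smul_mem' := by
    intro c u hu
    have hu' := (energy_lt_top_iff (Lp.aestronglyMeasurable u)).1 hu
    change energy α Ω _ < ∞
    rw [energy_congr (Lp.coeFn_smul c u), energy_lt_top_iff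
      ((Lp.aestronglyMeasurable u).const_smul c), quot_smul]
    exact hu'.const_smul c

/-- The regional Gagliardo seminorm on `H^α(Ω)`, denoted `‖u‖_{H_0^α(Ω)}`:
`(c_{N,α}/2 ∫_Ω ∫_Ω (u(x) - u(y))² / |x - y|^{N + 2α} dx dy)^{1/2}`. -/
def gagliardo {N : ℕ} (α : ℝ) (Ω : Set (EuclideanSpace ℝ (Fin N))) :
    Seminorm ℝ (HSpace α Ω) :=
  Seminorm.of (fun u => √(fracConst N α / 2 * (energy α Ω (u : Lp ℝ 2 (volume.restrict Ω))).toReal))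
    (by
      intro u v
      have hu := (energy_lt_top_iff (Lp.aestronglyMeasurable u.1)).1 u.2
      have hv := (energy_lt_top_iff (Lp.aestronglyMeasurable v.1)).1 v.2
      rw [Submodule.coe_add, energy_congr (Lp.coeFn_add u.1 v.1), energy_eq_eLpNorm
        ((Lp.aestronglyMeasurable u.1).add (Lp.aestronglyMeasurable v.1)),
        energy_eq_eLpNorm (Lp.aestronglyMeasurable u.1),
        energy_eq_eLpNorm (Lp.aestronglyMeasurable v.1), quot_add]
      rcases le_or_gt 0 (fracConst N α / 2) with hc | hc
      · simp only [ENNReal.toReal_pow, Real.sqrt_mul hc, Real.sqrt_sq ENNReal.toReal_nonneg]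
        rw [← mul_add, ← ENNReal.toReal_add hu.2.ne hv.2.ne]
        refine mul_le_mul_of_nonneg_left ?_ (Real.sqrt_nonneg _)
        exact ENNReal.toReal_mono (ENNReal.add_lt_top.2 ⟨hu.2, hv.2⟩).ne
          (eLpNorm_add_le hu.1 hv.1 (by norm_num))
      · rw [Real.sqrt_eq_zero_of_nonpos (mul_nonpos_of_nonpos_of_nonneg hc.le
          ENNReal.toReal_nonneg)]
        positivity)
    (by
      intro c u
      rw [Submodule.coe_smul, energy_congr (Lp.coeFn_smul c u.1), energy_eq_eLpNorm
        ((Lp.aestronglyMeasurable u.1).const_smul c),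
        energy_eq_eLpNorm (Lp.aestronglyMeasurable u.1), quot_smul, eLpNorm_const_smul]
      rw [mul_pow, ENNReal.toReal_mul, mul_left_comm, Real.sqrt_mul (by positivity)]
      simp [Real.sqrt_sq_eq_abs])

/-- The full norm on `H^α(Ω)`: the Gagliardo seminorm plus the `L²(Ω)` norm. -/
def fullNorm {N : ℕ} (α : ℝ) (Ω : Set (EuclideanSpace ℝ (Fin N))) :
    Seminorm ℝ (HSpace α Ω) :=
  gagliardo α Ω + (normSeminorm ℝ (Lp ℝ 2 (volume.restrict Ω))).comp (HSpace α Ω).subtype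

/-- `φ ∈ C_c²(Ω)`: a `C²` function with compact support contained in `Ω`. -/
def IsTestFunction {N : ℕ} (Ω : Set (EuclideanSpace ℝ (Fin N)))
    (φ : EuclideanSpace ℝ (Fin N) → ℝ) : Prop :=
  ContDiff ℝ 2 φ ∧ HasCompactSupport φ ∧ tsupport φ ⊆ Ω

/-- The space `H_0^α(Ω)`: the closure of `C_c²(Ω)` in `H^α(Ω)` with respect to the full norm. -/
def H0Space {N : ℕ} (α : ℝ) (Ω : Set (EuclideanSpace ℝ (Fin N))) :
    Submodule ℝ (HSpace α Ω) where
  carrier := {u | ∀ ε : ℝ, 0 < ε → ∃ φ : EuclideanSpace ℝ (Fin N) → ℝ, IsTestFunction Ω φ ∧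
    ∃ v : HSpace α Ω, (v : Lp ℝ 2 (volume.restrict Ω)) =ᵐ[volume.restrict Ω] φ ∧
      fullNorm α Ω (u - v) < ε}
  zero_mem' := by
    intro ε hε
    refine ⟨0, ⟨contDiff_const, HasCompactSupport.zero, by simp⟩, 0, ?_, by simpa using hε⟩
    exact Lp.coeFn_zero ℝ 2 _
  add_mem' := by
    intro u u' hu hu' ε hε
    obtain ⟨φ, hφ, v, hv, h⟩ := hu (ε / 2) (by linarith)
    obtain ⟨φ', hφ', v', hv', h'⟩ := hu' (ε / 2) (by linarith)
    refine ⟨φ + φ', ⟨hφ.1.add hφ'.1, hφ.2.1.add hφ'.2.1, ?_⟩, v + v', ?_, ?_⟩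
    · exact (tsupport_add φ φ').trans (Set.union_subset hφ.2.2 hφ'.2.2)
    · exact (Lp.coeFn_add v.1 v'.1).trans (hv.add hv')
    · rw [add_sub_add_comm]
      exact (map_add_le_add _ _ _).trans_lt (by linarith)
  smul_mem' := by
    intro c u hu ε hε
    obtain ⟨φ, hφ, v, hv, h⟩ := hu (ε / (‖c‖ + 1)) (by positivity)
    refine ⟨c • φ, ⟨hφ.1.const_smul c, hφ.2.1.smul_left (f := fun _ => c), ?_⟩, c • v, ?_, ?_⟩
    · exact (closure_mono (Function.support_const_smul_subset c φ)).trans hφ.2.2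
    · exact (Lp.coeFn_smul c v.1).trans (hv.const_smul c)
    · rw [← smul_sub, map_smul_eq_mul]
      rw [lt_div_iff₀ (by positivity)] at h
      nlinarith [apply_nonneg (fullNorm α Ω) (u - v), norm_nonneg c]

end RegionalFractional

end

open MeasureTheory
open scoped ENNReal

namespace RegionalFractional

section Poincare

variable {N : ℕ}

/-! The substance is a Poincaré inequality for test functions, `exists_lintegral_sq_le_energy`. Over
a boundary patch, compare integrals of `φ` on the dyadic slabs at height between `T` and `2T`,
divided by `T`. Halving `T` changes this quotient by at most a constant times `T^(α - 1/2) √energy`.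
Since `α > 1/2` these changes form a convergent geometric series, and the quotients vanish for small
`T` because `φ` has compact support in `Ω`. Hence the integral of `φ` over one fixed slab `G` is
controlled by the energy (`exists_abs_setIntegral_le_sqrt_energy`). On a bounded domain the kernel
is bounded below, so the energy also controls `φ x - φ y` on `Ω × G`. Together these bound `φ` in
`L²(Ω)`, and density gives the bound on `H0Space`. The other comparison is immediate. -/

/-! ### Height function near a boundary point -/

/-- `F` is the height above the graph of `γ` in direction `e`, and `D` is a cylinder parallel to
`e`. The local Lipschitz constant of `γ` gives the interior balls; sliding down by the height lands
on the graph, outside `Ω`. -/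
theorem exists_boundary_chart {Ω : Set (EuclideanSpace ℝ (Fin N))} (hΩ : IsOpen Ω)
    (hC2 : HasC2Boundary Ω) {x₀ : EuclideanSpace ℝ (Fin N)} (hx₀ : x₀ ∈ frontier Ω) :
    ∃ (e : EuclideanSpace ℝ (Fin N)) (F : EuclideanSpace ℝ (Fin N) → ℝ)
      (D : Set (EuclideanSpace ℝ (Fin N))) (t₀ ρ : ℝ), ‖e‖ = 1 ∧ 0 < t₀ ∧ 0 < ρ ∧ ρ ≤ 1 ∧
      Continuous F ∧ IsOpen D ∧ D.Nonempty ∧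
      (∀ x s, F (x + s • e) = F x + s) ∧ (∀ x (s : ℝ), x + s • e ∈ D ↔ x ∈ D) ∧
      (∀ x ∈ D, 0 < F x → F x ≤ 2 * t₀ → Metric.ball x (ρ * F x) ⊆ Ω) ∧
      (∀ x ∈ D, 0 < F x → F x ≤ 2 * t₀ → x - F x • e ∉ Ω) := by
  obtain ⟨e, he, γ, hγ, r, hr, hgraph⟩ := hC2 x₀ hx₀
  set P := (Submodule.span ℝ {e})ᗮ.orthogonalProjectionOnto with hP
  have hPe : P e = 0 := by
    rw [hP, Submodule.orthogonalProjectionOnto_eq_zero_iff, Submodule.orthogonal_orthogonal]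
    exact Submodule.mem_span_singleton_self e
  have hPn (x) : ‖P x‖ ≤ ‖x‖ := Submodule.norm_orthogonalProjectionOnto_apply_le _ x
  have hin (x) : |inner ℝ e x| ≤ ‖x‖ := by
    simpa [he] using abs_real_inner_le_norm e x
  have hdec (x) : ‖x‖ ≤ ‖P x‖ + |inner ℝ e x| := by
    have h := (Submodule.span ℝ {e}).starProjection_add_starProjection_orthogonal x
    rw [Submodule.starProjection_unit_singleton ℝ he] at h
    calc ‖x‖ = ‖inner ℝ e x • e + (Submodule.span ℝ {e})ᗮ.starProjection x‖ := by rw [h]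
      _ ≤ ‖inner ℝ e x • e‖ + ‖(Submodule.span ℝ {e})ᗮ.starProjection x‖ := norm_add_le _ _
      _ = ‖P x‖ + |inner ℝ e x| := by
        rw [norm_smul, he, Real.norm_eq_abs, mul_one, add_comm]; rfl
  obtain ⟨K, s, hs, hK⟩ := (hγ.contDiffAt (x := P x₀)).of_le (m := 1) (by norm_num)
    |>.exists_lipschitzOnWith
  obtain ⟨r₂, hr₂, hball⟩ := Metric.mem_nhds_iff.1 hs
  have hLip {a b} (ha : ‖a - P x₀‖ < r₂) (hb : ‖b - P x₀‖ < r₂) :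
      |γ a - γ b| ≤ K * ‖a - b‖ := by
    have := hK.dist_le_mul a (hball (by simpa [dist_eq_norm] using ha)) b
      (hball (by simpa [dist_eq_norm] using hb))
    simpa [dist_eq_norm] using this
  set F : EuclideanSpace ℝ (Fin N) → ℝ := fun x => inner ℝ e x - γ (P x) with hF
  have hFc : Continuous F := by
    have := hγ.continuous
    fun_prop
  have hFs (x) (s : ℝ) : F (x + s • e) = F x + s := by
    simp only [hF, map_add, map_smul, hPe, smul_zero, add_zero, inner_add_right, inner_smul_right,
      real_inner_self_eq_norm_sq, he]
    ring
  have hK0 : (0 : ℝ) ≤ K := K.2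
  -- Points of the cylinder of height at most `2δ` are within `(3 + K)δ` of `x₀`, and the interior
  -- balls add at most `δ`; their projections stay within `2δ` of `P x₀`.
  obtain ⟨δ, hδ, hδr, hδr₂⟩ : ∃ δ : ℝ, 0 < δ ∧ δ * (5 + K) < r ∧ 3 * δ < r₂ := by
    refine ⟨min (r / (2 * (5 + K))) (r₂ / 4), by positivity, ?_, ?_⟩
    · calc _ ≤ r / (2 * (5 + K)) * (5 + K) := by gcongr; exact min_le_left _ _
        _ = r / 2 := by field_simp
        _ < r := by linarith
    · have := min_le_right (r / (2 * (5 + K))) (r₂ / 4)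
      linarith
  have hx₀F : F x₀ = 0 := by
    have hcl : x₀ ∈ closure Ω := frontier_subset_closure hx₀
    have hn : x₀ ∉ Ω := by
      rw [hΩ.frontier_eq] at hx₀; exact hx₀.2
    apply le_antisymm
    · have := (hgraph x₀ (Metric.mem_ball_self hr)).not.1 hn
      simp only [hF]; linarith
    · by_contra! hlt
      have ho : IsOpen ({x | F x < 0} ∩ Metric.ball x₀ r) :=
        (isOpen_lt hFc continuous_const).inter Metric.isOpen_ball
      obtain ⟨y, ⟨hy, hyb⟩, hyΩ⟩ := mem_closure_iff.1 hcl _ ho ⟨hlt, Metric.mem_ball_self hr⟩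
      have := (hgraph y hyb).1 hyΩ
      simp only [hF, Set.mem_ofPred_eq] at hy
      linarith
  have hnear (x) (hx : ‖P x - P x₀‖ < δ) : ‖x - x₀‖ ≤ δ + (|F x| + K * δ) := by
    have h1 := hdec (x - x₀)
    rw [map_sub] at h1
    have h2 : inner ℝ e (x - x₀) = F x + (γ (P x) - γ (P x₀)) := by
      have : inner ℝ e x₀ = γ (P x₀) := by simp only [hF] at hx₀F; linarith
      rw [inner_sub_right, this]; simp only [hF]; ring
    have h3 : |γ (P x) - γ (P x₀)| ≤ K * δ :=
      (hLip (by linarith) (by simpa using hr₂)).trans (by gcongr)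
    rw [h2] at h1
    have := abs_add_le (F x) (γ (P x) - γ (P x₀))
    linarith
  -- The height varies with Lipschitz constant at most `1 + K` here, so on a ball of radius `F x /
  -- (2(1 + K))` it drops by less than half of `F x`.
  have hρ1 : 1 / (2 * (1 + (K : ℝ))) ≤ 1 / 2 := by
    apply one_div_le_one_div_of_le <;> linarith
  refine ⟨e, F, {x | ‖P x - P x₀‖ < δ}, δ, 1 / (2 * (1 + K)), he, hδ, by positivity, by linarith,
    hFc, ?_, ⟨x₀, by simpa using hδ⟩, hFs, ?_, ?_, ?_⟩
  · exact isOpen_lt (by fun_prop) continuous_const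
  · intro x s
    simp [hPe]
  · intro x hx h0 hle y hy
    rw [Metric.mem_ball, dist_eq_norm] at hy
    simp only [Set.mem_ofPred_eq] at hx
    have hρF : 1 / (2 * (1 + (K : ℝ))) * F x ≤ δ := by nlinarith
    have hyx : ‖y - x‖ < δ := hy.trans_le hρF
    have hn := hnear x hx
    rw [abs_of_pos h0] at hn
    have hyb : y ∈ Metric.ball x₀ r := by
      rw [Metric.mem_ball, dist_eq_norm]
      have := norm_sub_le_norm_sub_add_norm_sub y x x₀
      nlinarith
    refine (hgraph y hyb).2 ?_
    have hPyx : ‖P y - P x‖ ≤ ‖y - x‖ := by rw [← map_sub]; exact hPn _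
    have h1 : |γ (P y) - γ (P x)| ≤ K * ‖y - x‖ := by
      refine (hLip ?_ (by linarith)).trans (by gcongr)
      have := norm_sub_le_norm_sub_add_norm_sub (P y) (P x) (P x₀)
      linarith
    have h2 := hin (y - x)
    rw [inner_sub_right] at h2
    have h3 : (1 + K) * ‖y - x‖ < F x := by
      calc (1 + K) * ‖y - x‖ < (1 + K) * (1 / (2 * (1 + (K : ℝ))) * F x) := by gcongr
        _ = F x / 2 := by field_simp
        _ < F x := by linarith
    simp only [hF] at h3
    have := (abs_le.1 h1).2
    have := (abs_le.1 h2).1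
    change γ (P y) < inner ℝ e y
    linarith
  · intro x hx h0 hle hmem
    simp only [Set.mem_ofPred_eq] at hx
    have hF0 : F (x - F x • e) = 0 := by
      rw [sub_eq_add_neg, ← neg_smul, hFs]; ring
    have hPx : P (x - F x • e) = P x := by simp [hPe]
    have hn := hnear (x - F x • e) (by rwa [hPx])
    rw [hF0, abs_zero] at hn
    have hb : x - F x • e ∈ Metric.ball x₀ r := by
      rw [Metric.mem_ball, dist_eq_norm]
      nlinarith
    have := (hgraph _ hb).1 hmem
    change γ (P _) < _ at this
    simp only [hF] at hF0 this
    linarith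

/-! ### Translation differences bounded by the energy -/

/-- The points `x + w` and `x + z` both lie in `Ω` at distance at most `d`, so the kernel there is
at least `d^-(N + 2α)`. Translation invariance then allows both integrals to be enlarged to `Ω`. -/
theorem lintegral_shift_sub_sq_le {α : ℝ} {Ω G : Set (EuclideanSpace ℝ (Fin N))}
    (hα : 0 ≤ α) (hΩ : MeasurableSet Ω) (hG : MeasurableSet G)
    (φ : EuclideanSpace ℝ (Fin N) → ℝ) (w : EuclideanSpace ℝ (Fin N)) {r d : ℝ}
    (hd : ‖w‖ + r ≤ d) (hw : ∀ x ∈ G, x + w ∈ Ω) (hb : ∀ x ∈ G, Metric.ball x r ⊆ Ω) :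
    ∫⁻ x in G, ∫⁻ z in Metric.ball (0 : EuclideanSpace ℝ (Fin N)) r,
        ENNReal.ofReal ((φ (x + w) - φ (x + z)) ^ 2)
      ≤ ENNReal.ofReal (d ^ ((N : ℝ) + 2 * α)) * energy α Ω φ := by
  set H : EuclideanSpace ℝ (Fin N) → ℝ≥0∞ := fun x =>
    ∫⁻ y in Ω, ENNReal.ofReal ((φ x - φ y) ^ 2 / ‖x - y‖ ^ ((N : ℝ) + 2 * α)) with hH
  set c := ENNReal.ofReal (d ^ ((N : ℝ) + 2 * α)) with hc
  have hinner (x) (hx : x ∈ G) : ∫⁻ z in Metric.ball (0 : EuclideanSpace ℝ (Fin N)) r,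
        ENNReal.ofReal ((φ (x + w) - φ (x + z)) ^ 2) ≤ c * H (x + w) := by
    rw [hH, ← lintegral_const_mul' _ _ ENNReal.ofReal_ne_top, ← lintegral_indicator hΩ,
      ← lintegral_add_left_eq_self (μ := volume) (Ω.indicator _) x,
      ← lintegral_indicator measurableSet_ball]
    refine lintegral_mono fun z => ?_
    by_cases hz : z ∈ Metric.ball (0 : EuclideanSpace ℝ (Fin N)) r
    · have hz' : ‖z‖ < r := by simpa using hz
      have hxz : x + z ∈ Ω := hb x hx (by simpa using hz)
      rw [Set.indicator_of_mem hz, Set.indicator_of_mem hxz, ← ENNReal.ofReal_mul']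
      swap; · positivity
      apply ENNReal.ofReal_le_ofReal
      rcases eq_or_ne (x + w) (x + z) with h | h
      · simp [h]
      · have hpos : 0 < ‖x + w - (x + z)‖ := norm_pos_iff.2 (sub_ne_zero.2 h)
        have hle : ‖x + w - (x + z)‖ ≤ d := by
          rw [add_sub_add_left_eq_sub]
          linarith [norm_sub_le w z]
        rw [← mul_div_assoc, le_div_iff₀ (by positivity), mul_comm]
        gcongr
    · simp [Set.indicator_of_notMem hz]
  calc _ ≤ ∫⁻ x in G, c * H (x + w) := setLIntegral_mono' hG hinner
    _ = c * ∫⁻ x in G, H (x + w) := lintegral_const_mul' _ _ ENNReal.ofReal_ne_top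
    _ ≤ c * ∫⁻ x in Ω, H x := by
      refine mul_le_mul_right ?_ c
      rw [← lintegral_indicator hΩ, ← lintegral_add_right_eq_self (μ := volume) (Ω.indicator _) w, ← lintegral_indicator hG]
      refine lintegral_mono fun x => ?_
      by_cases hx : x ∈ G
      · rw [Set.indicator_of_mem hx, Set.indicator_of_mem (hw x hx)]
      · simp [Set.indicator_of_notMem hx]
    _ = _ := rfl

/-- A single translate is not seen by a double integral, so `φ (x + w)` and `φ x` are both compared
with `φ (x + z)` and integrated over `z` in a ball. The previous bound applies with shift `w` and
with shift `0`. -/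
theorem lintegral_translate_sub_sq_le {α : ℝ} {Ω G : Set (EuclideanSpace ℝ (Fin N))}
    (hα : 0 ≤ α) (hΩ : MeasurableSet Ω) (hG : MeasurableSet G)
    {φ : EuclideanSpace ℝ (Fin N) → ℝ} (hφ : Continuous φ) (w : EuclideanSpace ℝ (Fin N)) {r d : ℝ}
    (hr : 0 < r) (hd : ‖w‖ + r ≤ d) (hw : ∀ x ∈ G, x + w ∈ Ω)
    (hb : ∀ x ∈ G, Metric.ball x r ⊆ Ω) :
    (∫⁻ x in G, ENNReal.ofReal ((φ (x + w) - φ x) ^ 2)) *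
        volume (Metric.ball (0 : EuclideanSpace ℝ (Fin N)) r)
      ≤ 4 * (ENNReal.ofReal (d ^ ((N : ℝ) + 2 * α)) * energy α Ω φ) := by
  set B := Metric.ball (0 : EuclideanSpace ℝ (Fin N)) r
  have h1 := lintegral_shift_sub_sq_le hα hΩ hG φ w hd hw hb
  have h0 := lintegral_shift_sub_sq_le (r := r) (d := d) hα hΩ hG φ 0
    (by rw [norm_zero]; linarith [norm_nonneg w])
    (fun x hx => hb x hx (by simpa using hr)) hb
  have hmeas : Measurable fun x => ∫⁻ z in B, ENNReal.ofReal ((φ (x + w) - φ (x + z)) ^ 2) := by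
    refine Measurable.lintegral_prod_right'
      (f := fun p : EuclideanSpace ℝ (Fin N) × EuclideanSpace ℝ (Fin N) => ENNReal.ofReal ((φ (p.1 + w) - φ (p.1 + p.2)) ^ 2)) ?_
    exact (Continuous.measurable (by fun_prop)).ennreal_ofReal
  calc _ = ∫⁻ x in G, ENNReal.ofReal ((φ (x + w) - φ x) ^ 2) * volume B := by
        rw [lintegral_mul_const _ (by
          exact (Continuous.measurable (by fun_prop)).ennreal_ofReal)]
    _ ≤ ∫⁻ x in G, (2 * (∫⁻ z in B, ENNReal.ofReal ((φ (x + w) - φ (x + z)) ^ 2)) +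
          2 * ∫⁻ z in B, ENNReal.ofReal ((φ (x + 0) - φ (x + z)) ^ 2)) := by
        refine lintegral_mono fun x => ?_
        dsimp only
        rw [← setLIntegral_const, ← lintegral_const_mul' _ _ (by norm_num),
          ← lintegral_const_mul' _ _ (by norm_num), ← lintegral_add_left]
        · refine lintegral_mono fun z => ?_
          dsimp only
          have h2 : (2 : ℝ≥0∞) = ENNReal.ofReal 2 := by simp
          simp only [h2]
          rw [← ENNReal.ofReal_mul (by norm_num),
            ← ENNReal.ofReal_mul (by norm_num), ← ENNReal.ofReal_add (by positivity) (by positivity)]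
          apply ENNReal.ofReal_le_ofReal
          rw [add_zero]
          nlinarith [sq_nonneg (φ (x + w) - φ (x + z) + (φ x - φ (x + z)))]
        · exact (Continuous.measurable (by fun_prop)).ennreal_ofReal.const_mul _
    _ = 2 * (∫⁻ x in G, ∫⁻ z in B, ENNReal.ofReal ((φ (x + w) - φ (x + z)) ^ 2)) +
          2 * ∫⁻ x in G, ∫⁻ z in B, ENNReal.ofReal ((φ (x + 0) - φ (x + z)) ^ 2) := by
        rw [lintegral_add_left (hmeas.const_mul _), lintegral_const_mul' _ _ (by norm_num),
          lintegral_const_mul' _ _ (by norm_num)]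
    _ ≤ 2 * (ENNReal.ofReal (d ^ ((N : ℝ) + 2 * α)) * energy α Ω φ) +
          2 * (ENNReal.ofReal (d ^ ((N : ℝ) + 2 * α)) * energy α Ω φ) := by gcongr
    _ = _ := by rw [← add_mul]; norm_num

/-- Cauchy–Schwarz against the constant `1`, read off from `0 ≤ ∫ (m f - I)² = m (m J - I²)`. -/
theorem sq_setIntegral_le {X : Type*} [MeasurableSpace X] {μ : Measure X} {G : Set X}
    (hG : μ G ≠ ∞) {f : X → ℝ} (hf : IntegrableOn f G μ)
    (hf2 : IntegrableOn (fun x => f x ^ 2) G μ) :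
    (∫ x in G, f x ∂μ) ^ 2 ≤ μ.real G * ∫ x in G, f x ^ 2 ∂μ := by
  set m := μ.real G with hm
  set I := ∫ x in G, f x ∂μ with hI
  set J := ∫ x in G, f x ^ 2 ∂μ with hJ
  have hc : IntegrableOn (fun _ => I ^ 2) G μ := integrableOn_const hG
  have key : 0 ≤ ∫ x in G, (m * f x - I) ^ 2 ∂μ := integral_nonneg fun x => sq_nonneg _
  have : ∫ x in G, (m * f x - I) ^ 2 ∂μ = m ^ 2 * J - 2 * m * I * I + m * I ^ 2 := by
    have h1 : ∀ x, (m * f x - I) ^ 2 = m ^ 2 * f x ^ 2 - 2 * m * I * f x + I ^ 2 := by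
      intro x; ring
    simp_rw [h1]
    rw [integral_add (f := fun x => m ^ 2 * f x ^ 2 - 2 * m * I * f x)
        ((hf2.const_mul _).sub (hf.const_mul _)) hc,
      integral_sub (hf2.const_mul _) (hf.const_mul _), integral_const_mul, integral_const_mul,
      setIntegral_const, smul_eq_mul]
  rw [this] at key
  have hm0 : 0 ≤ m := measureReal_nonneg
  rcases hm0.eq_or_lt with h | h
  · have : I = 0 := by
      rw [hI, setIntegral_measure_zero]
      rwa [hm, eq_comm, measureReal_eq_zero_iff hG] at h
    rw [this, ← h]; simp
  · have : 0 ≤ m * (m * J - I ^ 2) := by nlinarith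
    have := nonneg_of_mul_nonneg_right this h
    linarith

theorem sq_setIntegral_translate_sub_le {α : ℝ} {Ω G : Set (EuclideanSpace ℝ (Fin N))}
    (hα : 0 ≤ α) (hΩ : MeasurableSet Ω) (hG : MeasurableSet G) (hGf : volume G ≠ ∞)
    {φ : EuclideanSpace ℝ (Fin N) → ℝ} (hφ : Continuous φ) (hφc : HasCompactSupport φ)
    (hE : energy α Ω φ ≠ ∞)
    (w : EuclideanSpace ℝ (Fin N)) {r d : ℝ}
    (hr : 0 < r) (hd : ‖w‖ + r ≤ d) (hw : ∀ x ∈ G, x + w ∈ Ω)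
    (hb : ∀ x ∈ G, Metric.ball x r ⊆ Ω) :
    (∫ x in G, (φ (x + w) - φ x)) ^ 2 ≤ volume.real G *
      (4 * (d ^ ((N : ℝ) + 2 * α) * (energy α Ω φ).toReal) /
        volume.real (Metric.ball (0 : EuclideanSpace ℝ (Fin N)) r)) := by
  have hfc : Continuous fun x => φ (x + w) - φ x := by fun_prop
  have hfs : HasCompactSupport fun x => φ (x + w) - φ x :=
    (hφc.comp_homeomorph (Homeomorph.addRight w)).sub hφc
  have hf2 : HasCompactSupport fun x => (φ (x + w) - φ x) ^ 2 :=
    hfs.comp_left (g := fun t : ℝ => t ^ 2) (by simp)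
  have hi2 : Integrable fun x => (φ (x + w) - φ x) ^ 2 :=
    (hfc.pow 2).integrable_of_hasCompactSupport hf2
  refine (sq_setIntegral_le hGf (hfc.integrable_of_hasCompactSupport hfs).integrableOn
    hi2.integrableOn).trans ?_
  gcongr
  have hBpos : 0 < volume.real (Metric.ball (0 : EuclideanSpace ℝ (Fin N)) r) :=
    ENNReal.toReal_pos (Metric.measure_ball_pos _ _ hr).ne' measure_ball_lt_top.ne
  have hd0 : 0 ≤ d := by linarith [norm_nonneg w]
  rw [le_div_iff₀ hBpos, integral_eq_lintegral_of_nonneg_ae (.of_forall fun x => sq_nonneg _)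
    (hi2.integrableOn.aestronglyMeasurable), measureReal_def, ← ENNReal.toReal_mul]
  refine (ENNReal.toReal_mono ?_
    (lintegral_translate_sub_sq_le hα hΩ hG hφ w hr hd hw hb)).trans ?_
  · exact ENNReal.mul_ne_top (by norm_num) (ENNReal.mul_ne_top ENNReal.ofReal_ne_top hE)
  · rw [ENNReal.toReal_mul, ENNReal.toReal_mul, ENNReal.toReal_ofReal (by positivity)]
    simp

/-! ### Slabs and their translates -/

/-- The part of `D` on which the height function `F` takes values in `(a, b]`. -/
def slab (D : Set (EuclideanSpace ℝ (Fin N))) (F : EuclideanSpace ℝ (Fin N) → ℝ) (a b : ℝ) :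
    Set (EuclideanSpace ℝ (Fin N)) :=
  {x | x ∈ D ∧ a < F x ∧ F x ≤ b}

section slab

variable {D : Set (EuclideanSpace ℝ (Fin N))} {F : EuclideanSpace ℝ (Fin N) → ℝ}
  {e : EuclideanSpace ℝ (Fin N)}

theorem measurableSet_slab (hF : Continuous F) (hD : IsOpen D) (a b : ℝ) :
    MeasurableSet (slab D F a b) :=
  hD.measurableSet.inter ((isOpen_lt continuous_const hF).measurableSet.inter
    (isClosed_le hF continuous_const).measurableSet)

theorem setIntegral_slab_add (hF : Continuous F) (hD : IsOpen D)
    (hFs : ∀ x (s : ℝ), F (x + s • e) = F x + s) (hDs : ∀ x (s : ℝ), x + s • e ∈ D ↔ x ∈ D)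
    (f : EuclideanSpace ℝ (Fin N) → ℝ) (a b s : ℝ) :
    ∫ x in slab D F (a + s) (b + s), f x = ∫ x in slab D F a b, f (x + s • e) := by
  rw [← integral_indicator (measurableSet_slab hF hD _ _),
    ← integral_indicator (measurableSet_slab hF hD _ _),
    ← integral_add_right_eq_self (μ := volume) _ (s • e)]
  congr 1
  ext x
  have : x + s • e ∈ slab D F (a + s) (b + s) ↔ x ∈ slab D F a b := by
    simp [slab, hFs, hDs]
  by_cases hx : x ∈ slab D F a b
  · rw [Set.indicator_of_mem hx, Set.indicator_of_mem (this.2 hx)]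
  · rw [Set.indicator_of_notMem hx, Set.indicator_of_notMem (mt this.1 hx)]

/-- The slab of heights `(2h, 4h]` is tiled exactly by the translates of `(h, 2h]` by `h` and `2h`;
half-open intervals make the union disjoint. This turns differences between scales into translation
differences. -/
theorem setIntegral_slab_two_mul (hF : Continuous F) (hD : IsOpen D)
    (hFs : ∀ x (s : ℝ), F (x + s • e) = F x + s) (hDs : ∀ x (s : ℝ), x + s • e ∈ D ↔ x ∈ D)
    {f : EuclideanSpace ℝ (Fin N) → ℝ} {h : ℝ}
    (hf : IntegrableOn f (slab D F (2 * h) (4 * h))) :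
    ∫ x in slab D F (2 * h) (4 * h), f x =
      (∫ x in slab D F h (2 * h), f (x + h • e)) +
        ∫ x in slab D F h (2 * h), f (x + (2 * h) • e) := by
  have hU : slab D F (2 * h) (4 * h) = slab D F (h + h) (2 * h + h) ∪
      slab D F (h + 2 * h) (2 * h + 2 * h) := by
    ext x
    simp only [slab, Set.mem_ofPred_eq, Set.mem_union]
    constructor
    · rintro ⟨h1, h2, h3⟩
      rcases le_or_gt (F x) (2 * h + h) with h4 | h4
      · exact Or.inl ⟨h1, by linarith, h4⟩
      · exact Or.inr ⟨h1, by linarith, by linarith⟩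
    · rintro (⟨h1, h2, h3⟩ | ⟨h1, h2, h3⟩) <;> exact ⟨h1, by linarith, by linarith⟩
  rw [hU] at hf ⊢
  rw [setIntegral_union _ (measurableSet_slab hF hD _ _) hf.left_of_union hf.right_of_union,
    setIntegral_slab_add hF hD hFs hDs, setIntegral_slab_add hF hD hFs hDs]
  rw [Set.disjoint_left]
  rintro x ⟨-, -, h1⟩ ⟨-, h2, -⟩
  linarith

end slab

/-! ### Telescoping towards the boundary -/

/-- This is where `α > 1/2` enters: it makes the ratio `q` smaller than `1`. Finiteness of the
energy is assumed because `toReal` sends `∞` to `0`. -/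
theorem exists_abs_setIntegral_le_sqrt_energy {α : ℝ} (hα : α ∈ Set.Ioo (1 / 2 : ℝ) 1)
    {Ω : Set (EuclideanSpace ℝ (Fin N))} (hΩ : IsOpen Ω) (hΩb : Bornology.IsBounded Ω)
    (hC2 : HasC2Boundary Ω) {x₀ : EuclideanSpace ℝ (Fin N)} (hx₀ : x₀ ∈ frontier Ω) :
    ∃ (G : Set (EuclideanSpace ℝ (Fin N))) (C : ℝ), MeasurableSet G ∧ G ⊆ Ω ∧ volume G ≠ 0 ∧
      0 ≤ C ∧ ∀ φ : EuclideanSpace ℝ (Fin N) → ℝ, IsTestFunction Ω φ → energy α Ω φ ≠ ∞ →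
        |∫ x in G, φ x| ≤ C * √(energy α Ω φ).toReal := by
  obtain ⟨hα1, hα2⟩ := hα
  obtain ⟨e, F, D, t₀, ρ, he, ht₀, hρ, hρ1, hF, hD, hDne, hFs, hDs, hin, hout⟩ :=
    exists_boundary_chart hΩ hC2 hx₀
  have hslab (a b : ℝ) : MeasurableSet (slab D F a b) := measurableSet_slab hF hD a b
  have hsub {a b : ℝ} (ha : 0 ≤ a) (hb : b ≤ 2 * t₀) : slab D F a b ⊆ Ω := by
    rintro x ⟨hxD, h1, h2⟩
    have : 0 < F x := ha.trans_lt h1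
    exact hin x hxD this (h2.trans hb) (Metric.mem_ball_self (by positivity))
  have hΩv : volume Ω ≠ ∞ := hΩb.measure_lt_top.ne
  have hfin {a b : ℝ} (ha : 0 ≤ a) (hb : b ≤ 2 * t₀) : volume (slab D F a b) ≠ ∞ :=
    measure_ne_top_of_subset (hsub ha hb) hΩv
  set T : ℕ → ℝ := fun k => t₀ * (1 / 2) ^ k with hT
  have hTpos (k) : 0 < T k := by positivity
  have hTsucc (k) : T k = 2 * T (k + 1) := by simp only [hT, pow_succ]; ring
  have hTle (k) : T k ≤ t₀ := by
    have : ((1 : ℝ) / 2) ^ k ≤ 1 := pow_le_one₀ (by norm_num) (by norm_num)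
    simp only [hT]; nlinarith
  set v : ℝ := volume.real (slab D F t₀ (2 * t₀)) / t₀ with hv
  -- By the tiling, halving the height halves the volume; so `m k` below is the mean over the slab
  -- times the fixed factor `v`.
  have hvol (k) : volume.real (slab D F (T k) (2 * T k)) = T k * v := by
    induction k with
    | zero => simp only [hT, hv, pow_zero, mul_one]; field_simp
    | succ k ih =>
      have h1 := setIntegral_slab_two_mul (f := fun _ => 1) hF hD hFs hDs
        (h := T (k + 1)) (integrableOn_const (hfin (by linarith [hTpos (k + 1)])
          (by linarith [hTsucc k, hTle k])))
      have h4 : 4 * T (k + 1) = 2 * T k := by rw [hTsucc k]; ring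
      rw [h4, ← hTsucc, setIntegral_const, setIntegral_const, ih] at h1
      simp only [smul_eq_mul, mul_one] at h1
      rw [hTsucc k] at h1
      linarith
  set b : ℝ := volume.real (Metric.ball (0 : EuclideanSpace ℝ (Fin N)) 1) with hb
  have hbpos : 0 < b :=
    ENNReal.toReal_pos (Metric.measure_ball_pos _ _ one_pos).ne' measure_ball_lt_top.ne
  have hv0 : 0 ≤ v := by positivity
  have hball {r : ℝ} (hr : 0 < r) :
      volume.real (Metric.ball (0 : EuclideanSpace ℝ (Fin N)) r) = r ^ N * b := by
    rw [measureReal_def, Measure.addHaar_ball_of_pos _ _ hr, ENNReal.toReal_mul,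
      ENNReal.toReal_ofReal (by positivity), finrank_euclideanSpace_fin]
    rfl
  set A : ℝ := v * (4 * 3 ^ ((N : ℝ) + 2 * α)) / (ρ ^ N * b) with hA
  set q : ℝ := (1 / 2) ^ (α - 1 / 2) with hq
  have hq0 : 0 < q := by positivity
  have hq1 : q < 1 := Real.rpow_lt_one (by norm_num) (by norm_num) (by linarith)
  -- The sum of the geometric series, multiplied by `t₀` to undo the normalization of `m 0`.
  refine ⟨slab D F t₀ (2 * t₀), t₀ * (√A * t₀ ^ (α - 1 / 2) * q / (1 - q)), hslab _ _,
    hsub ht₀.le le_rfl, ?_, ?_, ?_⟩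
  · obtain ⟨x, hx⟩ := hDne
    have ho : IsOpen (D ∩ {x | t₀ < F x ∧ F x < 2 * t₀}) :=
      hD.inter ((isOpen_lt continuous_const hF).inter (isOpen_lt hF continuous_const))
    refine ((ho.measure_pos volume ⟨x + (3 / 2 * t₀ - F x) • e, (hDs _ _).2 hx, ?_⟩).trans_le
      (measure_mono ?_)).ne'
    · simp only [Set.mem_ofPred_eq, hFs]
      constructor <;> linarith
    · rintro y ⟨hy, h1, h2⟩
      exact ⟨hy, h1, h2.le⟩
  · have : 0 < 1 - q := by linarith
    positivity
  intro φ ⟨hφ, hφc, hφs⟩ hE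
  set 𝓔 := (energy α Ω φ).toReal with h𝓔
  have hφcont := hφ.continuous
  have hφi : Integrable φ := hφcont.integrable_of_hasCompactSupport hφc
  set m : ℕ → ℝ := fun k => (T k)⁻¹ * ∫ x in slab D F (T k) (2 * T k), φ x with hm
  have hstep (k) : dist (m k) (m (k + 1)) ≤ (√A * t₀ ^ (α - 1 / 2) * q * √𝓔) * q ^ k := by
    set h := T (k + 1) with hh
    have hh0 : 0 < h := hTpos _
    have hh1 : 2 * h ≤ t₀ := by rw [hh, ← hTsucc]; exact hTle k
    have hbnd (s : ℝ) (hs : 0 ≤ s) (hs2 : s ≤ 2 * h) :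
        |∫ x in slab D F h (2 * h), (φ (x + s • e) - φ x)| ≤ √A * √𝓔 * (h ^ (α - 1 / 2) * h) := by
      -- Everything scales with `h`: shifts are at most `2h` and `ρ ≤ 1`, so `d = 3h` suffices.
      -- Shifted heights are at most `4h ≤ 2t₀`, within the chart.
      have := sq_setIntegral_translate_sub_le (α := α) (by linarith) hΩ.measurableSet
        (hslab h (2 * h)) (hfin hh0.le (by linarith)) hφcont hφc hE (s • e) (r := ρ * h)
        (d := 3 * h) (by positivity) (by
          rw [norm_smul, he, Real.norm_of_nonneg hs]; nlinarith) (by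
          rintro x ⟨hx, h1, h2⟩
          refine hsub (a := 0) (b := 2 * t₀) le_rfl le_rfl ⟨(hDs _ _).2 hx, ?_, ?_⟩ <;> rw [hFs] <;>
            linarith) (by
          rintro x ⟨hx, h1, h2⟩
          refine (Metric.ball_subset_ball ?_).trans (hin x hx (by linarith) (by linarith))
          gcongr)
      rw [hvol, hball (by positivity), ← h𝓔] at this
      refine (Real.abs_le_sqrt this).trans_eq ?_
      have e1 : h * v * (4 * ((3 * h) ^ ((N : ℝ) + 2 * α) * 𝓔) / ((ρ * h) ^ N * b))
          = A * 𝓔 * (h ^ (α - 1 / 2) * h) ^ 2 := by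
        -- The factor `h^N` cancels against the ball volume; with the slab volume this leaves `h^(1
        -- + 2α)`.
        have e2 : (h ^ (α - 1 / 2)) ^ 2 * h * h ^ N = h ^ ((N : ℝ) + 2 * α) := by
          rw [← Real.rpow_natCast (h ^ _) 2, ← Real.rpow_mul hh0.le, ← Real.rpow_natCast h N,
            ← Real.rpow_add_one hh0.ne', ← Real.rpow_add hh0]
          congr 1; push_cast; ring
        rw [Real.mul_rpow (by norm_num) hh0.le, ← e2, hA, mul_pow ρ h N]
        field_simp
      rw [e1, Real.sqrt_mul (by positivity), Real.sqrt_mul (by positivity),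
        Real.sqrt_sq (by positivity)]
    have hI (s : ℝ) : ∫ x in slab D F h (2 * h), (φ (x + s • e) - φ x)
        = (∫ x in slab D F h (2 * h), φ (x + s • e)) - ∫ x in slab D F h (2 * h), φ x :=
      integral_sub (hφi.comp_add_right _).integrableOn hφi.integrableOn
    have h1 := hbnd h hh0.le (by linarith)
    have h2 := hbnd (2 * h) (by linarith) le_rfl
    have h3 := setIntegral_slab_two_mul hF hD hFs hDs (h := h) hφi.integrableOn
    have h4 : m k - m (k + 1) = (2 * h)⁻¹ *
        ((∫ x in slab D F h (2 * h), (φ (x + h • e) - φ x)) +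
          ∫ x in slab D F h (2 * h), (φ (x + (2 * h) • e) - φ x)) := by
      simp only [hm]
      rw [hTsucc k, ← hh, show 2 * (2 * h) = 4 * h by ring, h3, hI, hI]
      field_simp
      ring
    have h5 : h ^ (α - 1 / 2) = t₀ ^ (α - 1 / 2) * q * q ^ k := by
      rw [hh, hT, Real.mul_rpow ht₀.le (by positivity), hq, ← Real.rpow_natCast,
        ← Real.rpow_mul (by norm_num), mul_comm _ (α - 1 / 2), Real.rpow_mul (by norm_num),
        Real.rpow_natCast, pow_succ]
      ring
    rw [Real.dist_eq, h4, abs_mul, abs_of_pos (by positivity)]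
    calc _ ≤ (2 * h)⁻¹ * (√A * √𝓔 * (h ^ (α - 1 / 2) * h) + √A * √𝓔 * (h ^ (α - 1 / 2) * h)) := by
          gcongr
          exact (abs_add_le _ _).trans (add_le_add h1 h2)
      _ = √A * √𝓔 * h ^ (α - 1 / 2) := by field_simp; ring
      _ = _ := by rw [h5]; ring
  -- In fact `m k` is eventually zero: a point of a thin slab is within `δ` of its foot on the
  -- graph, which lies outside `Ω`, whereas the `δ`-thickening of the support lies inside.
  have hlim : Filter.Tendsto m Filter.atTop (nhds 0) := by
    obtain ⟨δ, hδ, hthick⟩ := hφc.exists_thickening_subset_open hΩ hφs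
    have hT0 : Filter.Tendsto T Filter.atTop (nhds 0) := by
      simpa only [mul_zero] using (tendsto_pow_atTop_nhds_zero_of_lt_one (r := (1 / 2 : ℝ))
        (by norm_num) (by norm_num)).const_mul t₀
    refine tendsto_const_nhds.congr' ?_
    filter_upwards [hT0.eventually_lt_const (half_pos hδ)] with k hk
    have : ∫ x in slab D F (T k) (2 * T k), φ x = 0 := by
      refine setIntegral_eq_zero_of_forall_eq_zero fun x ⟨hx, h1, h2⟩ => ?_
      by_contra hne
      have hF0 : 0 < F x := (hTpos k).trans h1
      refine hout x hx hF0 (h2.trans (by linarith [hTle k])) (hthick ?_)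
      refine Metric.mem_thickening_iff.2 ⟨x, subset_tsupport _ hne, ?_⟩
      rw [dist_eq_norm, sub_sub_cancel_left, norm_neg, norm_smul, he, Real.norm_of_nonneg hF0.le]
      linarith
    simp only [hm, this, mul_zero]
  have := dist_le_of_le_geometric_of_tendsto₀ q _ hq1 hstep hlim
  rw [Real.dist_eq, sub_zero] at this
  simp only [hm, hT, pow_zero, mul_one] at this
  rw [abs_mul, abs_of_pos (by positivity), inv_mul_le_iff₀ ht₀] at this
  exact this.trans_eq (by ring)

/-! ### Poincaré inequality for test functions -/

theorem lintegral_lintegral_sub_sq_le {α R : ℝ} {Ω G : Set (EuclideanSpace ℝ (Fin N))}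
    (hα : 0 ≤ α) (hΩ : MeasurableSet Ω) (hG : MeasurableSet G) (hGΩ : G ⊆ Ω)
    (hR : ∀ x ∈ Ω, ∀ y ∈ Ω, ‖x - y‖ ≤ R) (φ : EuclideanSpace ℝ (Fin N) → ℝ) :
    ∫⁻ x in Ω, ∫⁻ y in G, ENNReal.ofReal ((φ x - φ y) ^ 2)
      ≤ ENNReal.ofReal (R ^ ((N : ℝ) + 2 * α)) * energy α Ω φ := by
  unfold energy
  rw [← lintegral_const_mul' _ _ ENNReal.ofReal_ne_top]
  refine setLIntegral_mono' hΩ fun x hx => ?_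
  rw [← lintegral_const_mul' _ _ ENNReal.ofReal_ne_top]
  refine (setLIntegral_mono' hG fun y hy => ?_).trans (lintegral_mono_set hGΩ)
  rw [← ENNReal.ofReal_mul']
  swap; · positivity
  apply ENNReal.ofReal_le_ofReal
  rcases eq_or_ne x y with rfl | h
  · simp
  · have hpos : 0 < ‖x - y‖ := norm_pos_iff.2 (sub_ne_zero.2 h)
    have := hR x hx y (hGΩ hy)
    rw [← mul_div_assoc, le_div_iff₀ (by positivity), mul_comm]
    gcongr

/-- Write `μ(G) φ(x)` as `∫_G (φ(x) - φ(y)) dy + ∫_G φ`, use `(a + b)² ≤ 2a² + 2b²`, and apply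
Cauchy–Schwarz to the first integral. -/
theorem ofReal_sq_le_lintegral_sub_sq_add {X : Type*} [MeasurableSpace X] {μ : Measure X}
    {G : Set X} (hG : MeasurableSet G) (hGv : μ G ≠ ∞) (hg : 0 < μ.real G) {φ : X → ℝ}
    (hφ : Integrable φ μ) (hφ2 : Integrable (fun x => φ x ^ 2) μ) {A : ℝ}
    (hA : (∫ x in G, φ x ∂μ) ^ 2 ≤ A) (x : X) :
    ENNReal.ofReal (φ x ^ 2) ≤ ENNReal.ofReal (2 / μ.real G) *
      (∫⁻ y in G, ENNReal.ofReal ((φ x - φ y) ^ 2) ∂μ) +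
        ENNReal.ofReal (2 / μ.real G ^ 2 * A) := by
  have hA0 : 0 ≤ A := (sq_nonneg _).trans hA
  have hi : IntegrableOn (fun y => φ x - φ y) G μ :=
    (integrableOn_const hGv).sub hφ.integrableOn
  have hi2 : IntegrableOn (fun y => (φ x - φ y) ^ 2) G μ := by
    have : IntegrableOn (fun y => φ x ^ 2 - 2 * φ x * φ y + φ y ^ 2) G μ :=
      ((integrableOn_const hGv).sub (hφ.integrableOn.const_mul _)).add hφ2.integrableOn
    refine this.congr_fun (fun y _ => ?_) hG
    ring
  have h1 := sq_setIntegral_le hGv hi hi2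
  have hc : IntegrableOn (fun _ => φ x) G μ := integrableOn_const hGv
  rw [integral_sub hc hφ.integrableOn, setIntegral_const, smul_eq_mul] at h1
  rw [← ofReal_integral_eq_lintegral_ofReal hi2 (.of_forall fun _ => sq_nonneg _),
    ← ENNReal.ofReal_mul (by positivity), ← ENNReal.ofReal_add
      (mul_nonneg (by positivity) (integral_nonneg fun _ => sq_nonneg _)) (by positivity)]
  apply ENNReal.ofReal_le_ofReal
  generalize (∫ y in G, (φ x - φ y) ^ 2 ∂μ) = J at h1 ⊢
  generalize (∫ y in G, φ y ∂μ) = I at h1 hA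
  generalize μ.real G = g at *
  have h2 : (g * φ x) ^ 2 ≤ 2 * (g * J) + 2 * A := by
    nlinarith [sq_nonneg (g * φ x - 2 * I)]
  have h3 : 2 / g * J + 2 / g ^ 2 * A = (2 * (g * J) + 2 * A) / g ^ 2 := by
    field_simp
  rw [h3, le_div_iff₀ (by positivity)]
  linarith

/-- The Poincaré inequality for test functions and the regional energy. -/
theorem exists_lintegral_sq_le_energy {α : ℝ} (hα : α ∈ Set.Ioo (1 / 2 : ℝ) 1)
    {Ω : Set (EuclideanSpace ℝ (Fin N))} (hΩ : IsOpen Ω) (hΩb : Bornology.IsBounded Ω)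
    (hC2 : HasC2Boundary Ω) (hfr : (frontier Ω).Nonempty) :
    ∃ C : ℝ, 0 ≤ C ∧ ∀ φ : EuclideanSpace ℝ (Fin N) → ℝ, IsTestFunction Ω φ → energy α Ω φ ≠ ∞ →
      ∫⁻ x in Ω, ENNReal.ofReal (φ x ^ 2) ≤ ENNReal.ofReal (C * (energy α Ω φ).toReal) := by
  obtain ⟨x₀, hx₀⟩ := hfr
  obtain ⟨G, C, hG, hGΩ, hG0, hC, hmain⟩ :=
    exists_abs_setIntegral_le_sqrt_energy hα hΩ hΩb hC2 hx₀
  have hα0 : 0 ≤ α := by linarith [hα.1]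
  have hΩv : volume Ω ≠ ∞ := hΩb.measure_lt_top.ne
  have hGv : volume G ≠ ∞ := measure_ne_top_of_subset hGΩ hΩv
  have hg : 0 < volume.real G := ENNReal.toReal_pos hG0 hGv
  set g := volume.real G with hgdef
  obtain ⟨R, hR0, hR⟩ : ∃ R : ℝ, 0 ≤ R ∧ ∀ x ∈ Ω, ∀ y ∈ Ω, ‖x - y‖ ≤ R := by
    obtain ⟨R, hR⟩ := Metric.isBounded_iff.1 hΩb
    refine ⟨max R 0, le_max_right _ _, fun x hx y hy => le_max_of_le_left ?_⟩
    simpa [dist_eq_norm] using hR hx hy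
  set M := R ^ ((N : ℝ) + 2 * α) with hM
  have hM0 : 0 ≤ M := by positivity
  -- The first term comes from the differences on `Ω × G`, the second from the integral of `φ` over
  -- `G`.
  refine ⟨2 / g * M + 2 / g ^ 2 * C ^ 2 * volume.real Ω, by positivity, fun φ hφ hE => ?_⟩
  set 𝓔 := (energy α Ω φ).toReal with h𝓔
  have h𝓔0 : 0 ≤ 𝓔 := ENNReal.toReal_nonneg
  have hI : (∫ x in G, φ x) ^ 2 ≤ C ^ 2 * 𝓔 := by
    have := pow_le_pow_left₀ (abs_nonneg _) (hmain φ hφ hE) 2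
    rw [sq_abs] at this
    rwa [mul_pow, Real.sq_sqrt h𝓔0] at this
  obtain ⟨hφ2, hφc, -⟩ := hφ
  have hcont := hφ2.continuous
  have hφi : Integrable φ := hcont.integrable_of_hasCompactSupport hφc
  have hφc2 : HasCompactSupport fun x => φ x ^ 2 :=
    hφc.comp_left (g := fun t : ℝ => t ^ 2) (by simp)
  have hφi2 : Integrable fun x => φ x ^ 2 := (hcont.pow 2).integrable_of_hasCompactSupport hφc2
  have hpt (x) := ofReal_sq_le_lintegral_sub_sq_add hG hGv hg hφi hφi2 hI x
  calc ∫⁻ x in Ω, ENNReal.ofReal (φ x ^ 2)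
      ≤ ∫⁻ x in Ω, (ENNReal.ofReal (2 / g) * (∫⁻ y in G, ENNReal.ofReal ((φ x - φ y) ^ 2)) +
          ENNReal.ofReal (2 / g ^ 2 * (C ^ 2 * 𝓔))) := lintegral_mono hpt
    _ = ENNReal.ofReal (2 / g) * (∫⁻ x in Ω, ∫⁻ y in G, ENNReal.ofReal ((φ x - φ y) ^ 2)) +
          ENNReal.ofReal (2 / g ^ 2 * (C ^ 2 * 𝓔)) * volume Ω := by
        rw [lintegral_add_right _ measurable_const, setLIntegral_const,
          lintegral_const_mul' _ _ ENNReal.ofReal_ne_top]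
    _ ≤ ENNReal.ofReal (2 / g) * (ENNReal.ofReal M * ENNReal.ofReal 𝓔) +
          ENNReal.ofReal (2 / g ^ 2 * (C ^ 2 * 𝓔)) * ENNReal.ofReal (volume.real Ω) := by
        rw [h𝓔, ENNReal.ofReal_toReal hE, measureReal_def, ENNReal.ofReal_toReal hΩv]
        gcongr
        exact lintegral_lintegral_sub_sq_le hα0 hΩ.measurableSet hG hGΩ hR φ
    _ = _ := by
        rw [← ENNReal.ofReal_mul hM0, ← ENNReal.ofReal_mul (by positivity),
          ← ENNReal.ofReal_mul (by positivity), ← ENNReal.ofReal_add (by positivity)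
            (by positivity)]
        congr 1; ring

/-! ### Passage to the closure and conclusion -/

theorem fullNorm_apply {α : ℝ} {Ω : Set (EuclideanSpace ℝ (Fin N))} (u : HSpace α Ω) :
    fullNorm α Ω u = gagliardo α Ω u + ‖(u : Lp ℝ 2 (volume.restrict Ω))‖ := rfl

theorem gagliardo_apply {α : ℝ} {Ω : Set (EuclideanSpace ℝ (Fin N))} (u : HSpace α Ω) :
    gagliardo α Ω u =
      √(fracConst N α / 2 * (energy α Ω (u : Lp ℝ 2 (volume.restrict Ω))).toReal) := rfl

theorem norm_sq_eq_lintegral {Ω : Set (EuclideanSpace ℝ (Fin N))}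
    (v : Lp ℝ 2 (volume.restrict Ω)) {φ : EuclideanSpace ℝ (Fin N) → ℝ}
    (hv : v =ᵐ[volume.restrict Ω] φ) :
    ‖v‖ ^ 2 = (∫⁻ x in Ω, ENNReal.ofReal (φ x ^ 2)).toReal := by
  rw [Lp.norm_def, ← ENNReal.toReal_pow, eLpNorm_congr_ae hv]
  have := eLpNorm_nnreal_pow_eq_lintegral (f := φ) (p := 2) (μ := volume.restrict Ω) (by norm_num)
  simp only [NNReal.coe_ofNat, ENNReal.coe_ofNat, ENNReal.rpow_ofNat] at this
  rw [this]
  congr 2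
  ext x
  rw [Real.enorm_eq_ofReal_abs, ← ENNReal.ofReal_pow (abs_nonneg _), sq_abs]

theorem exists_fullNorm_le_gagliardo {α : ℝ} (hα : α ∈ Set.Ioo (1 / 2 : ℝ) 1)
    {Ω : Set (EuclideanSpace ℝ (Fin N))} (hΩ : IsOpen Ω) (hΩb : Bornology.IsBounded Ω)
    (hC2 : HasC2Boundary Ω) (hfr : (frontier Ω).Nonempty) :
    ∃ C : ℝ, 0 < C ∧ ∀ u ∈ H0Space α Ω, fullNorm α Ω u ≤ C * gagliardo α Ω u := by
  obtain ⟨C, hC, hmain⟩ := exists_lintegral_sq_le_energy hα hΩ hΩb hC2 hfr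
  have hc : 0 < fracConst N α := fracConst_pos ⟨by linarith [hα.1], hα.2⟩
  set B := √(C / (fracConst N α / 2)) with hB
  have hB0 : 0 ≤ B := Real.sqrt_nonneg _
  have htest (φ : EuclideanSpace ℝ (Fin N) → ℝ) (hφ : IsTestFunction Ω φ) (v : HSpace α Ω)
      (hv : (v : Lp ℝ 2 (volume.restrict Ω)) =ᵐ[volume.restrict Ω] φ) :
      ‖(v : Lp ℝ 2 (volume.restrict Ω))‖ ≤ B * gagliardo α Ω v := by
    have hE : energy α Ω φ ≠ ∞ := by
      rw [← energy_congr hv]; exact ne_of_lt v.2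
    have h1 := ENNReal.toReal_mono ENNReal.ofReal_ne_top (hmain φ hφ hE)
    rw [← norm_sq_eq_lintegral _ hv, ENNReal.toReal_ofReal (by positivity)] at h1
    rw [gagliardo_apply, energy_congr hv, hB, ← Real.sqrt_mul (by positivity)]
    apply Real.le_sqrt_of_sq_le
    refine h1.trans_eq ?_
    field_simp
  refine ⟨1 + B, by positivity, fun u hu => ?_⟩
  refine le_of_forall_pos_le_add fun ε hε => ?_
  -- Replacing `u` by `v` costs one full norm of `u - v` on the left and at most `1 + B` of them on
  -- the right.
  obtain ⟨φ, hφ, v, hv, h⟩ := hu (ε / (2 + B)) (by positivity)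
  have h1 := htest φ hφ v hv
  have h2 : fullNorm α Ω u ≤ fullNorm α Ω v + fullNorm α Ω (u - v) := by
    simpa using map_add_le_add (fullNorm α Ω) v (u - v)
  have h3 : gagliardo α Ω v ≤ gagliardo α Ω u + gagliardo α Ω (u - v) := by
    have := map_add_le_add (gagliardo α Ω) u (v - u)
    rwa [add_sub_cancel, map_sub_rev] at this
  have h4 : gagliardo α Ω (u - v) ≤ fullNorm α Ω (u - v) := by
    rw [fullNorm_apply]; linarith [norm_nonneg ((u - v : HSpace α Ω) : Lp ℝ 2 (volume.restrict Ω))]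
  rw [lt_div_iff₀ (by positivity)] at h
  rw [fullNorm_apply v] at h2
  nlinarith

end Poincare

end RegionalFractional

theorem proposition3p2 (N : ℕ) (hN : 2 ≤ N) (α : ℝ) (hα : α ∈ Set.Ioo (1 / 2 : ℝ) 1)
    (Ω : Set (EuclideanSpace ℝ (Fin N))) (hΩ : IsOpen Ω) (hΩb : Bornology.IsBounded Ω)
    (hΩC2 : RegionalFractional.HasC2Boundary Ω) :
    (∀ u ∈ RegionalFractional.H0Space α Ω, RegionalFractional.gagliardo α Ω u = 0 → u = 0) ∧
    (∀ u ∈ RegionalFractional.H0Space α Ω, RegionalFractional.fullNorm α Ω u = 0 → u = 0) ∧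
    ∃ c C : ℝ, 0 < c ∧ 0 < C ∧ ∀ u ∈ RegionalFractional.H0Space α Ω,
      c * RegionalFractional.gagliardo α Ω u ≤ RegionalFractional.fullNorm α Ω u ∧
      RegionalFractional.fullNorm α Ω u ≤ C * RegionalFractional.gagliardo α Ω u := by
  have hfull (u : RegionalFractional.HSpace α Ω) (hu : RegionalFractional.fullNorm α Ω u = 0) :
      u = 0 := by
    rw [RegionalFractional.fullNorm_apply] at hu
    have h1 := apply_nonneg (RegionalFractional.gagliardo α Ω) u
    have h2 := norm_nonneg (u : Lp ℝ 2 (volume.restrict Ω))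
    exact Subtype.ext (norm_eq_zero.1 (by linarith))
  have hequiv : ∃ C : ℝ, 0 < C ∧ ∀ u ∈ RegionalFractional.H0Space α Ω,
      RegionalFractional.fullNorm α Ω u ≤ C * RegionalFractional.gagliardo α Ω u := by
    -- The Poincaré argument needs a boundary point. The empty set has none, but there `L²` is
    -- trivial; a nonempty bounded `Ω` is not the whole space, so its frontier is nonempty.
    rcases Ω.eq_empty_or_nonempty with rfl | hne
    · refine ⟨1, one_pos, fun u _ => ?_⟩
      have : (u : Lp ℝ 2 (volume.restrict (∅ : Set (EuclideanSpace ℝ (Fin N))))) = 0 := by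
        apply Lp.ext
        simp [Filter.EventuallyEq]
      rw [RegionalFractional.fullNorm_apply, this]
      simp
    · refine RegionalFractional.exists_fullNorm_le_gagliardo hα hΩ hΩb hΩC2 ?_
      have : Nontrivial (EuclideanSpace ℝ (Fin N)) := by
        have : Nonempty (Fin N) := ⟨⟨0, by omega⟩⟩
        infer_instance
      refine nonempty_frontier_iff.2 ⟨hne, fun h => ?_⟩
      exact NormedSpace.unbounded_univ ℝ _ (h ▸ hΩb)
  obtain ⟨C, hC, hle⟩ := hequiv
  -- Definiteness of the seminorm on `H0Space` follows from the comparison and definiteness of the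
  -- full norm; `c = 1` works because the seminorm is a summand of the full norm.
  refine ⟨fun u hu h => hfull u ?_, fun u _ h => hfull u h, 1, C, one_pos, hC, fun u hu =>
    ⟨?_, hle u hu⟩⟩
  · have := hle u hu
    rw [h, mul_zero] at this
    exact le_antisymm this (apply_nonneg _ _)
  · rw [RegionalFractional.fullNorm_apply]
    linarith [norm_nonneg (u : Lp ℝ 2 (volume.restrict Ω))]
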